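/- Let $G$ be a compact Hausdorff group and $K$ a closed subgroup such that $(G,K)$ is a Gelfand pair, i.e. the convolution algebra $L^1(K\backslash G/K)$ of (almost everywhere) $K$-bi-invariant integrable functions on $G$ is commutative. Let $\widehat G$ be the unitary dual of $G$ (irreducible continuous unitary representations up to unitary equivalence); for each class fix a representative $\pi$ on a finite-dimensional complex inner product space $V_\pi$ of dimension $d_\pi$. Call $\pi$ spherical if there is a non-zero $u\in V_\pi$ with $\pi(k)u=u$ for all $k\in K$, and let $\widehat G_s\subseteq\widehat G$ be the set of spherical classes. Put $E_\pi^K=\int_K\pi(k)\,dk$ (normalised Haar measure on $K$). For each $\pi\in\widehat G$ fix an orthonormal basis $e_1^\pi,\dots,e_{d_\pi}^\pi$ of $V_\pi$, with $e_1^\pi$ fixed by $\pi(K)$ if $\pi\in\widehat G_s$, and for a linear operator $A$ on $V_\pi$ write $A_{ij}=\langle Ae_i^\pi,e_j^\pi\rangle$, the inner product being linear in its first argument. Let $\mu$ be a finite regular positive Borel measure on $G$, and let $\widehat\mu(\pi)=\int_G\pi(g^{-1})\,\mu(dg)$. Call $\mu$ $K$-left-invariant if $\mu(kA)=\mu(A)$,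 and $K$-right-invariant if $\mu(Ak)=\mu(A)$, for all $k\in K$ and Borel $A\subseteq G$; call it $K$-bi-invariant if it is both. 1. The following are equivalent: (a) $\mu$ is $K$-left-invariant; (b) $\widehat\mu(\pi)E_\pi^K=\widehat\mu(\pi)$ for all $\pi\in\widehat G_s$, and $\widehat\mu(\pi)=0$ for all $\pi\notin\widehat G_s$; (c) $\widehat\mu(\pi)_{ij}=0$ whenever $\pi\notin\widehat G_s$, or $\pi\in\widehat G_s$ and $i\neq1$. 2. The following are equivalent: (a) $\mu$ is $K$-right-invariant; (b) $E_\pi^K\widehat\mu(\pi)=\widehat\mu(\pi)$ for all $\pi\in\widehat G_s$, and $\widehat\mu(\pi)=0$ for all $\pi\notin\widehat G_s$; (c) $\widehat\mu(\pi)_{ij}=0$ whenever $\pi\notin\widehat G_s$, or $\pi\in\widehat G_s$ and $j\neq1$. 3. The following are equivalent: (a) $\mu$ is $K$-bi-invariant; (b) $E_\pi^K\widehat\mu(\pi)E_\pi^K=\widehat\mu(\pi)$ for all $\pi\in\widehat G_s$, and $\widehat\mu(\pi)=0$ for all $\pi\notin\widehat G_s$; (c) $\widehat\mu(\pi)_{ij}=0$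 whenever $\pi\notin\widehat G_s$, or $\pi\in\widehat G_s$ and $(i,j)\neq(1,1)$. -/

import Mathlib

open MeasureTheory
open scoped InnerProductSpace

namespace CompactPair

universe u

section Reps

variable (G : Type u) [Group G] [TopologicalSpace G]

/-- A continuous irreducible unitary representation of `G` on a finite-dimensional complex
inner product space.  (For compact `G` every irreducible unitary representation is of this kind.) -/
structure UnitaryIrrep where
  /-- the representation space -/
  V : Type
  [normed : NormedAddCommGroup V]
  [ips : InnerProductSpace ℂ V]
  [finDim : FiniteDimensional ℂ V]
  /-- the homomorphism from `G` to the linear maps of `V` -/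
  ρ : Representation ℂ G V
  inner_map : ∀ (g : G) (v w : V), ⟪ρ g v, ρ g w⟫_ℂ = ⟪v, w⟫_ℂ
  continuous_map : ∀ v : V, Continuous fun g : G => ρ g v
  irreducible : ρ.IsIrreducible

attribute [instance] UnitaryIrrep.normed UnitaryIrrep.ips UnitaryIrrep.finDim

variable {G}

namespace UnitaryIrrep

/-- Unitary equivalence: an isometric linear isomorphism intertwining the two representations. -/
def UnitarilyEquivalent (π σ : UnitaryIrrep G) : Prop :=
  ∃ T : π.V ≃ₗᵢ[ℂ] σ.V, ∀ (g : G) (v : π.V), T (π.ρ g v) = σ.ρ g (T v)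

theorem unitarilyEquivalent_equivalence :
    Equivalence (UnitarilyEquivalent (G := G)) where
  refl π := ⟨LinearIsometryEquiv.refl ℂ π.V, fun _ _ => rfl⟩
  symm := by
    rintro π σ ⟨T, hT⟩
    refine ⟨T.symm, fun g v => T.injective ?_⟩
    rw [hT]; simp
  trans := by
    rintro π σ τ ⟨T, hT⟩ ⟨S, hS⟩
    refine ⟨T.trans S, fun g v => ?_⟩
    simp [hT, hS]

instance setoid : Setoid (UnitaryIrrep G) := ⟨UnitarilyEquivalent, unitarilyEquivalent_equivalence⟩

theorem nontrivial_space (π : UnitaryIrrep G) : Nontrivial π.V := by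
  by_contra h
  rw [not_nontrivial_iff_subsingleton] at h
  obtain ⟨a, b, hab⟩ := π.irreducible.toNontrivial
  exact hab (SetLike.ext fun x => by
    rw [Subsingleton.elim x 0]
    exact ⟨fun _ => b.toSubmodule.zero_mem, fun _ => a.toSubmodule.zero_mem⟩)

/-- The dimension of the representation space. -/
noncomputable def dim (π : UnitaryIrrep G) : ℕ := Module.finrank ℂ π.V

theorem dim_pos (π : UnitaryIrrep G) : 0 < π.dim :=
  haveI := π.nontrivial_space
  Module.finrank_pos

/-- The first element of the index set `Fin π.dim` of an orthonormal basis
(the index written `1` when indices run from `1` to `dim V`). -/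
noncomputable def first (π : UnitaryIrrep G) : Fin π.dim := ⟨0, π.dim_pos⟩

/-- The operator `π(g)` as a bounded operator. -/
noncomputable def op (π : UnitaryIrrep G) (g : G) : π.V →L[ℂ] π.V :=
  (π.ρ g).toContinuousLinearMap

/-- The space of vectors fixed by `K`. -/
noncomputable def fixedSpace (K : ClosedSubgroup G) (π : UnitaryIrrep G) : Submodule ℂ π.V :=
  Representation.invariants (π.ρ.comp K.toSubgroup.subtype)

/-- A representation is spherical if it has a non-zero `K`-fixed vector. -/
def IsSpherical (K : ClosedSubgroup G) (π : UnitaryIrrep G) : Prop :=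
  ∃ u : π.V, u ≠ 0 ∧ ∀ k ∈ K, π.ρ k u = u

/-- The matrix entries `A_{ij} = ⟨A e_i, e_j⟩` of an operator in an orthonormal basis, for an inner
product that is linear in the first argument; Mathlib's is linear in the second one. -/
noncomputable def entry (π : UnitaryIrrep G) (e : OrthonormalBasis (Fin π.dim) ℂ π.V)
    (A : π.V →L[ℂ] π.V) (i j : Fin π.dim) : ℂ :=
  ⟪e j, A (e i)⟫_ℂ

end UnitaryIrrep

variable (G) in
/-- The unitary dual: irreducible unitary representations up to unitary equivalence. -/
def UnitaryDual : Type (max 1 u) := Quotient (UnitaryIrrep.setoid (G := G))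

end Reps

section Measures

variable {G : Type u} [Group G] [TopologicalSpace G] [IsTopologicalGroup G] [CompactSpace G]
  [MeasurableSpace G] [BorelSpace G]

variable (G) in
/-- Haar measure on a compact group, normalised to total mass one. -/
noncomputable def haarProb : Measure G :=
  Measure.haarMeasure (⊤ : TopologicalSpace.PositiveCompacts G)

/-- Convolution of functions on `G`. -/
noncomputable def conv (f h : G → ℂ) (x : G) : ℂ := ∫ y, f y * h (y⁻¹ * x) ∂(haarProb G)

/-- Almost everywhere `K`-bi-invariant functions. -/
def AEBiInvariant (K : ClosedSubgroup G) (f : G → ℂ) : Prop :=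
  ∀ k ∈ K, ∀ k' ∈ K, (fun g => f (k * g * k')) =ᵐ[haarProb G] f

/-- `(G, K)` is a Gelfand pair: the convolution algebra `L¹(K\G/K)` is commutative. -/
def IsGelfandPair (K : ClosedSubgroup G) : Prop :=
  ∀ f h : G → ℂ, Integrable f (haarProb G) → Integrable h (haarProb G) →
    AEBiInvariant K f → AEBiInvariant K h → conv f h =ᵐ[haarProb G] conv h f

/-- The operator `E_π^K = ∫_K π(k) dk`. -/
noncomputable def avgOp (K : ClosedSubgroup G) (π : UnitaryIrrep G) : π.V →L[ℂ] π.V :=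
  haveI : CompactSpace K.toSubgroup := isCompact_iff_compactSpace.mp K.isClosed'.isCompact
  ∫ k : K.toSubgroup, π.op (k : G) ∂(haarProb K.toSubgroup)

/-- The Fourier transform `μ̂(π) = ∫_G π(g⁻¹) μ(dg)`. -/
noncomputable def fourier (μ : Measure G) (π : UnitaryIrrep G) : π.V →L[ℂ] π.V :=
  ∫ g, π.op g⁻¹ ∂μ

/-- `μ(kA) = μ(A)` for all `k ∈ K` and all Borel sets `A`. -/
def KLeftInvariant (K : ClosedSubgroup G) (μ : Measure G) : Prop :=
  ∀ k ∈ K, ∀ A : Set G, MeasurableSet A → μ ((fun g => k * g) '' A) = μ A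

/-- `μ(Ak) = μ(A)` for all `k ∈ K` and all Borel sets `A`. -/
def KRightInvariant (K : ClosedSubgroup G) (μ : Measure G) : Prop :=
  ∀ k ∈ K, ∀ A : Set G, MeasurableSet A → μ ((fun g => g * k) '' A) = μ A

/-- Invariance on both sides. -/
def KBiInvariant (K : ClosedSubgroup G) (μ : Measure G) : Prop :=
  KLeftInvariant K μ ∧ KRightInvariant K μ

end Measures

end CompactPair

/-! Left translation of `μ` by `k` turns `fourier μ π` into `fourier μ π ∘ π(k⁻¹)`; right
translation puts `π(k⁻¹)` on the other side. Since a finite regular measure is determined by its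
transform (`ext_of_fourier_eq`), invariance means that every transform absorbs `π(k)`, `k ∈ K`, on
the corresponding side. Equivalently it absorbs the average `avgOp K π`, which is the orthogonal
projection onto the `K`-fixed vectors (`avgOp_eq_starProjection`). For non-spherical `π` this
projection is zero, so the transform vanishes. For a Gelfand pair the fixed space is at most a line
(`IsGelfandPair.eq_zero_of_inner_eq_zero`), so the projection keeps the first basis vector and kills
the others; (c) is the absorption identity in coordinates.

Uniqueness of the transform rests on Peter–Weyl: convolution by an even real kernel is compact and
self-adjoint, its eigenspaces for non-zero eigenvalues are finite-dimensional and
translation-invariant, and such kernels approximate the identity. The bound on the fixed space comes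
from comparing the two convolutions of matrix coefficients by Schur's lemma. -/

namespace CompactPair

universe u

/-! ### Compactness of operators given by a continuous family of vectors. -/

section InnerOperator

variable {X H : Type*} [TopologicalSpace X] [CompactSpace X] [NormedAddCommGroup H]
  [InnerProductSpace ℂ H]

/-- The operator `f ↦ (x ↦ ⟪Ψ x, f⟫)` attached to a continuous family of vectors. -/
noncomputable def innerOperator (Ψ : C(X, H)) : H →L[ℂ] C(X, ℂ) :=
  LinearMap.mkContinuous
    { toFun := fun f => ⟨fun x => ⟪Ψ x, f⟫_ℂ, by fun_prop⟩
      map_add' := fun f g => by ext x; simp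
      map_smul' := fun c f => by ext x; simp } ‖Ψ‖ fun f => by
    rw [ContinuousMap.norm_le _ (by positivity)]
    exact fun x => (norm_inner_le_norm _ _).trans (by gcongr; exact Ψ.norm_coe_le_norm x)

@[simp] theorem innerOperator_apply (Ψ : C(X, H)) (f : H) (x : X) :
    innerOperator Ψ f x = ⟪Ψ x, f⟫_ℂ := rfl

/-- Arzelà–Ascoli: on the unit ball the values are bounded by `‖Ψ‖`, and `‖Ψ y - Ψ x‖` is a modulus
of continuity common to all images. -/
theorem isCompactOperator_innerOperator (Ψ : C(X, H)) : IsCompactOperator (innerOperator Ψ) := by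
  refine (isCompactOperator_iff_image_closedBall_subset_compact
    (innerOperator Ψ).toLinearMap one_pos).2 ?_
  let I := (ContinuousMap.isometryEquivBoundedOfCompact X ℂ)
  let A : Set (BoundedContinuousFunction X ℂ) := I '' (innerOperator Ψ '' Metric.closedBall 0 1)
  have hA : IsCompact (closure A) := by
    refine BoundedContinuousFunction.arzela_ascoli (Metric.closedBall 0 ‖Ψ‖)
      (isCompact_closedBall _ _) A ?_ ?_
    · rintro _ x ⟨_, ⟨f, hf, rfl⟩, rfl⟩
      rw [mem_closedBall_zero_iff] at hf ⊢
      change ‖⟪Ψ x, f⟫_ℂ‖ ≤ _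
      refine (norm_inner_le_norm _ _).trans ?_
      calc ‖Ψ x‖ * ‖f‖ ≤ ‖Ψ‖ * 1 := by gcongr; exact Ψ.norm_coe_le_norm x
        _ = _ := mul_one _
    · intro x
      rw [Metric.equicontinuousAt_iff_right]
      intro ε hε
      filter_upwards [Metric.continuous_iff'.1 Ψ.continuous x ε hε] with y hy
      rintro ⟨_, ⟨_, ⟨f, hf, rfl⟩, rfl⟩⟩
      rw [mem_closedBall_zero_iff] at hf
      change dist ⟪Ψ x, f⟫_ℂ ⟪Ψ y, f⟫_ℂ < ε
      rw [dist_comm, dist_eq_norm, ← inner_sub_left]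
      rw [dist_eq_norm] at hy
      refine (norm_inner_le_norm _ _).trans_lt (lt_of_le_of_lt ?_ hy)
      exact mul_le_of_le_one_right (norm_nonneg _) hf
  refine ⟨I.symm '' closure A, hA.image I.symm.continuous, ?_⟩
  rintro _ ⟨f, hf, rfl⟩
  exact ⟨_, subset_closure ⟨_, ⟨f, hf, rfl⟩, rfl⟩, I.symm_apply_apply _⟩

end InnerOperator

/-! ### Normalised Haar measure. -/

section Haar

variable (G : Type u) [Group G] [TopologicalSpace G] [IsTopologicalGroup G] [CompactSpace G]
  [MeasurableSpace G] [BorelSpace G]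

instance : (haarProb G).IsHaarMeasure := by unfold haarProb; infer_instance

instance [T2Space G] : (haarProb G).Regular := by unfold haarProb; infer_instance

instance : IsProbabilityMeasure (haarProb G) :=
  ⟨by simpa [haarProb] using Measure.haarMeasure_self (K₀ := (⊤ : TopologicalSpace.PositiveCompacts G))⟩

end Haar

/-! ### The Peter–Weyl density theorem. -/

section PeterWeyl

variable {G : Type u} [Group G] [TopologicalSpace G] [IsTopologicalGroup G]

/-- Left translation of continuous functions, `(L_g f)(x) = f(g⁻¹x)`. -/
noncomputable def leftTranslation : Representation ℂ G C(G, ℂ) where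
  toFun g :=
    { toFun := fun f => f.comp ⟨fun x => g⁻¹ * x, by fun_prop⟩
      map_add' := fun _ _ => rfl
      map_smul' := fun _ _ => rfl }
  map_one' := by ext; simp
  map_mul' g h := by ext; simp [mul_assoc]

@[simp] theorem leftTranslation_apply (g : G) (f : C(G, ℂ)) (x : G) :
    leftTranslation g f x = f (g⁻¹ * x) := rfl

theorem continuous_leftTranslation (f : C(G, ℂ)) :
    Continuous fun g : G => leftTranslation g f :=
  ContinuousMap.continuous_of_continuous_uncurry _
    (by simp only [Function.uncurry_def, leftTranslation_apply]; fun_prop)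

variable [CompactSpace G] [MeasurableSpace G] [BorelSpace G]

/-- The kernel `φ(x⁻¹y)` as a continuous family of square integrable functions of `y`. -/
noncomputable def kernelFamily (φ : C(G, ℝ)) : C(G, Lp ℂ 2 (haarProb G)) where
  toFun x := ContinuousMap.toLp 2 (haarProb G) ℂ ⟨fun y => (φ (x⁻¹ * y) : ℂ), by fun_prop⟩
  continuous_toFun := (ContinuousMap.toLp 2 (haarProb G) ℂ).continuous.comp
    (ContinuousMap.continuous_of_continuous_uncurry _
      (by simp only [Function.uncurry_def, ContinuousMap.coe_mk]; fun_prop))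

/-- The convolution operator with kernel `φ(x⁻¹y)`. -/
noncomputable def convOperator (φ : C(G, ℝ)) : Lp ℂ 2 (haarProb G) →L[ℂ] C(G, ℂ) :=
  innerOperator (kernelFamily φ)

theorem convOperator_toLp (φ : C(G, ℝ)) (h : C(G, ℂ)) (x : G) :
    convOperator φ (ContinuousMap.toLp 2 (haarProb G) ℂ h) x
      = ∫ y, h y * (φ (x⁻¹ * y) : ℂ) ∂(haarProb G) := by
  simp only [convOperator, innerOperator_apply, kernelFamily, ContinuousMap.coe_mk]
  rw [ContinuousMap.inner_toLp]
  simp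

/-- The kernel `φ(x⁻¹y)` depends only on `x⁻¹y` and Haar measure is left-invariant. This is what
makes the eigenspaces translation-invariant. -/
theorem convOperator_leftTranslation (φ : C(G, ℝ)) (h : C(G, ℂ)) (g : G) :
    convOperator φ (ContinuousMap.toLp 2 (haarProb G) ℂ (leftTranslation g h))
      = leftTranslation g (convOperator φ (ContinuousMap.toLp 2 (haarProb G) ℂ h)) := by
  ext x
  rw [leftTranslation_apply, convOperator_toLp, convOperator_toLp,
    ← integral_mul_left_eq_self _ g]
  simp [mul_assoc]

/-- For even real `φ` the kernel is real and symmetric in `x` and `y`; Fubini settles continuous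
functions, and these are dense in `L²`. -/
theorem isSymmetric_convOperator [T2Space G] (φ : C(G, ℝ)) (hφ : ∀ x, φ x⁻¹ = φ x) :
    ((ContinuousMap.toLp 2 (haarProb G) ℂ ∘L convOperator φ) :
      Lp ℂ 2 (haarProb G) →L[ℂ] Lp ℂ 2 (haarProb G)).IsSymmetric := by
  set ι := ContinuousMap.toLp (E := ℂ) 2 (haarProb G) ℂ
  have hd : DenseRange ι := ContinuousMap.toLp_denseRange ℂ (haarProb G) ℂ (by simp)
  intro f₁ f₂
  refine hd.induction_on₂ (p := fun f₁ f₂ => ⟪(ι ∘L convOperator φ) f₁, f₂⟫_ℂ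
    = ⟪f₁, (ι ∘L convOperator φ) f₂⟫_ℂ) (isClosed_eq (by fun_prop) (by fun_prop)) ?_ f₁ f₂
  intro h₁ h₂
  simp only [ContinuousLinearMap.comp_apply, ι]
  rw [ContinuousMap.inner_toLp, ContinuousMap.inner_toLp]
  simp only [convOperator_toLp, ← integral_conj, ← integral_const_mul, ← integral_mul_const]
  rw [integral_integral_swap_of_hasCompactSupport]
  · refine integral_congr_ae (.of_forall fun y => integral_congr_ae (.of_forall fun x => ?_))
    simp only [map_mul, Complex.conj_ofReal]
    rw [← hφ (x⁻¹ * y)]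
    simp
    ring
  · simp only [Function.uncurry_def]; fun_prop
  · exact HasCompactSupport.of_compactSpace _

/-- A continuous functional killing every finite-dimensional translation-invariant space of
continuous functions kills the range of convolution by a symmetric function. -/
theorem apply_convOperator_eq_zero [T2Space G] (Λ : C(G, ℂ) →L[ℂ] ℂ)
    (hΛ : ∀ W : Subrepresentation (leftTranslation (G := G)), FiniteDimensional ℂ W.toSubmodule →
      ∀ f ∈ W, Λ f = 0)
    (φ : C(G, ℝ)) (hφ : ∀ x, φ x⁻¹ = φ x) (f : Lp ℂ 2 (haarProb G)) :
    Λ (convOperator φ f) = 0 := by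
  set ι := ContinuousMap.toLp (E := ℂ) 2 (haarProb G) ℂ
  have hι : Function.Injective ι := ContinuousMap.toLp_injective (haarProb G)
  set T := ι ∘L convOperator φ with hT
  have hcomp : IsCompactOperator T := (isCompactOperator_innerOperator _).clm_comp ι
  have hspec := ContinuousLinearMap.orthogonalComplement_iSup_eigenspaces_eq_bot hcomp
    (isSymmetric_convOperator φ hφ)
  -- Eigenspaces are taken inside `C(G, ℂ)`, where `Λ` and translation live; `ι` embeds them in
  -- those of `T`, whence their finite dimension for `c ≠ 0`.
  let W (c : ℂ) : Subrepresentation (leftTranslation (G := G)) :=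
    { toSubmodule := LinearMap.ker ((convOperator φ ∘L ι).toLinearMap - c • LinearMap.id)
      apply_mem_toSubmodule := fun g v hv => by
        simp only [LinearMap.mem_ker, LinearMap.sub_apply, LinearMap.smul_apply, LinearMap.id_apply,
          ContinuousLinearMap.coe_coe, ContinuousLinearMap.comp_apply, sub_eq_zero] at hv ⊢
        rw [convOperator_leftTranslation, hv, map_smul] }
  have hW (c : ℂ) (h : C(G, ℂ)) : h ∈ W c ↔ convOperator φ (ι h) = c • h := by
    change h ∈ LinearMap.ker _ ↔ _
    simp [sub_eq_zero]
  have hfin (c : ℂ) (hc : c ≠ 0) : FiniteDimensional ℂ (W c).toSubmodule := by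
    have := ContinuousLinearMap.finite_dimensional_eigenspace hcomp c hc
    have hmap : ∀ h ∈ (W c).toSubmodule, ι h ∈ Module.End.eigenspace T.toLinearMap c := by
      intro h hh
      rw [Module.End.mem_eigenspace_iff]
      change ι (convOperator φ (ι h)) = _
      rw [(hW c h).1 hh, map_smul]
    refine FiniteDimensional.of_injective (ι.toLinearMap.restrict hmap) ?_
    intro a b hab
    exact Subtype.ext (hι (congrArg Subtype.val hab))
  have hle : (⨆ c, Module.End.eigenspace (T : Module.End ℂ _) c)
      ≤ LinearMap.ker (Λ ∘L convOperator φ).toLinearMap := by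
    refine iSup_le fun c v hv => ?_
    rw [Module.End.mem_eigenspace_iff] at hv
    change ι (convOperator φ v) = c • v at hv
    change Λ (convOperator φ v) = 0
    -- Injectivity of `ι` disposes of the kernel of `T`. Otherwise `convOperator φ v` is a
    -- continuous eigenfunction for `c`, hence in `W c`.
    by_cases hc : c = 0
    · rw [hc, zero_smul] at hv
      rw [hι (hv.trans (map_zero ι).symm), map_zero]
    · refine hΛ (W c) (hfin c hc) _ ((hW c _).2 ?_)
      rw [hv, map_smul]
  have hdense := (Submodule.topologicalClosure_eq_top_iff).2 hspec
  have hmem : f ∈ (⨆ c, Module.End.eigenspace (T : Module.End ℂ _) c).topologicalClosure := by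
    rw [hdense]; trivial
  exact Submodule.topologicalClosure_minimal _ hle (ContinuousLinearMap.isClosed_ker (Λ ∘L convOperator φ)) hmem

/-- Symmetric approximate identities: convolution by a suitable symmetric function moves a given
continuous function by at most `ε`. -/
theorem exists_norm_convOperator_sub_le [T2Space G] (f : C(G, ℂ)) {ε : ℝ} (hε : 0 < ε) :
    ∃ φ : C(G, ℝ), (∀ x, φ x⁻¹ = φ x) ∧
      ‖convOperator φ (ContinuousMap.toLp 2 (haarProb G) ℂ f) - f‖ ≤ ε := by
  -- Uniform continuity of `f` is encoded as continuity at `1` of right translation in the sup norm.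
  let R : G → C(G, ℂ) := fun u => ⟨fun x => f (x * u), by fun_prop⟩
  have hR : Continuous R := ContinuousMap.continuous_of_continuous_uncurry _
    (by simp only [Function.uncurry_def, R, ContinuousMap.coe_mk]; fun_prop)
  have hR1 : R 1 = f := by ext x; simp [R]
  have hU : {u | ‖R u - f‖ < ε} ∈ nhds (1 : G) := by
    have h := Metric.continuous_iff'.1 hR 1 ε hε
    simp only [hR1, dist_eq_norm] at h
    exact h
  obtain ⟨V, hVU, hV, h1V⟩ := mem_nhds_iff.1 hU
  -- Support in `V ∩ V⁻¹` ensures that the symmetrisation `ψ x + ψ x⁻¹` still vanishes off `V`.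
  have h1 : Disjoint ({1} : Set G) (V ∩ V⁻¹)ᶜ := by simp [h1V]
  obtain ⟨ψ, hψ1, hψ0, -, hψ⟩ := exists_continuous_one_zero_of_isCompact isCompact_singleton
    (hV.inter hV.inv).isClosed_compl h1
  let φ₀ : C(G, ℝ) := ⟨fun x => ψ x + ψ x⁻¹, by fun_prop⟩
  have hφ₀nn : ∀ x, 0 ≤ φ₀ x := fun x => add_nonneg (hψ x).1 (hψ x⁻¹).1
  have hφ₀V : ∀ x, x ∉ V → φ₀ x = 0 := by
    intro x hx
    have h2 : ψ x = 0 := hψ0 (by simp [hx])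
    have h3 : ψ x⁻¹ = 0 := hψ0 (by simp [hx])
    simp [φ₀, h2, h3]
  have hpos : 0 < ∫ x, φ₀ x ∂(haarProb G) := by
    refine φ₀.continuous.integral_pos_of_hasCompactSupport_nonneg_nonzero
      (HasCompactSupport.of_compactSpace _) hφ₀nn (x := 1) ?_
    have h2 : ψ 1 = 1 := hψ1 rfl
    simp [φ₀, h2]
  set c := ∫ x, φ₀ x ∂(haarProb G)
  let φ : C(G, ℝ) := ⟨fun x => c⁻¹ * φ₀ x, by fun_prop⟩
  have hφint : ∫ x, φ x ∂(haarProb G) = 1 := by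
    simp only [φ, ContinuousMap.coe_mk, integral_const_mul]
    exact inv_mul_cancel₀ hpos.ne'
  have hφnn : ∀ x, 0 ≤ φ x := fun x => mul_nonneg (inv_nonneg.2 hpos.le) (hφ₀nn x)
  have hint : ∀ {F : G → ℂ}, Continuous F → Integrable F (haarProb G) := fun hF =>
    hF.integrable_of_hasCompactSupport (HasCompactSupport.of_compactSpace _)
  refine ⟨φ, fun x => by simp [φ, φ₀, add_comm], ?_⟩
  rw [ContinuousMap.norm_le _ hε.le]
  intro x
  have hx : f x = ∫ y, f x * (φ y : ℂ) ∂(haarProb G) := by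
    rw [integral_const_mul, integral_complex_ofReal, hφint]; simp
  rw [ContinuousMap.sub_apply, convOperator_toLp, ← integral_mul_left_eq_self _ x]
  simp only [inv_mul_cancel_left]
  rw [hx]
  rw [← integral_sub (hint (by fun_prop)) (hint (by fun_prop))]
  calc ‖∫ y, (f (x * y) * (φ y : ℂ) - f x * (φ y : ℂ)) ∂(haarProb G)‖
      ≤ ∫ y, ε * φ y ∂(haarProb G) := by
        refine norm_integral_le_of_norm_le ?_ (.of_forall fun y => ?_)
        · exact Continuous.integrable_of_hasCompactSupport (by fun_prop)
            (HasCompactSupport.of_compactSpace _)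
        · rw [← sub_mul, norm_mul, Complex.norm_real, Real.norm_of_nonneg (hφnn y)]
          by_cases hy : y ∈ V
          · gcongr
            · exact hφnn y
            exact ((R y - f).norm_coe_le_norm x).trans (hVU hy).le
          · simp [φ, hφ₀V y hy]
    _ = ε := by rw [integral_const_mul, hφint, mul_one]

/-- **Peter–Weyl**: the finite-dimensional translation-invariant spaces of continuous functions
span a dense subspace of `C(G)`. -/
theorem eq_zero_of_forall_invariant [T2Space G] (Λ : C(G, ℂ) →L[ℂ] ℂ)
    (hΛ : ∀ W : Subrepresentation (leftTranslation (G := G)), FiniteDimensional ℂ W.toSubmodule →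
      ∀ f ∈ W, Λ f = 0) : Λ = 0 := by
  ext f
  rw [zero_apply, ← norm_eq_zero]
  refine le_antisymm (le_of_forall_pos_le_add fun ε hε => ?_) (norm_nonneg _)
  -- `Λ` kills the smoothed function, so `Λ f` is controlled by the smoothing error; the `+ 1`
  -- covers `Λ = 0`.
  obtain ⟨φ, hφ, h⟩ := exists_norm_convOperator_sub_le f (ε := ε / (‖Λ‖ + 1)) (by positivity)
  have h0 := apply_convOperator_eq_zero Λ hΛ φ hφ (ContinuousMap.toLp 2 (haarProb G) ℂ f)
  have h1 := Λ.le_opNorm (convOperator φ (ContinuousMap.toLp 2 (haarProb G) ℂ f) - f)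
  rw [map_sub, h0, zero_sub, norm_neg] at h1
  calc ‖Λ f‖ ≤ ‖Λ‖ * (ε / (‖Λ‖ + 1)) := h1.trans (by gcongr)
    _ ≤ (‖Λ‖ + 1) * (ε / (‖Λ‖ + 1)) := by gcongr; linarith
    _ = 0 + ε := by field_simp; simp

end PeterWeyl

/-! ### From irreducible representations to uniqueness of the Fourier transform. -/

section FiniteDimensional

theorem integrable_of_continuous {X E : Type*} [TopologicalSpace X] [CompactSpace X]
    [MeasurableSpace X] [BorelSpace X] [NormedAddCommGroup E] (μ : Measure X)
    [IsFiniteMeasure μ] {f : X → E} (hf : Continuous f) : Integrable f μ :=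
  hf.integrable_of_hasCompactSupport (HasCompactSupport.of_compactSpace f)

variable {G : Type u} [Group G] [TopologicalSpace G]

namespace UnitaryIrrep

@[simp] theorem op_apply (π : UnitaryIrrep G) (g : G) (v : π.V) : π.op g v = π.ρ g v := rfl

theorem continuous_op (π : UnitaryIrrep G) : Continuous π.op :=
  continuous_clm_apply.2 π.continuous_map

theorem continuous_map_inv [IsTopologicalGroup G] (π : UnitaryIrrep G) (v : π.V) :
    Continuous fun g => π.ρ g⁻¹ v :=
  (π.continuous_map v).comp continuous_inv

end UnitaryIrrep

variable [IsTopologicalGroup G] [CompactSpace G] [MeasurableSpace G] [BorelSpace G]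

theorem fourier_apply (μ : Measure G) [IsFiniteMeasure μ] (π : UnitaryIrrep G) (v : π.V) :
    fourier μ π v = ∫ g, π.ρ g⁻¹ v ∂μ :=
  ContinuousLinearMap.integral_apply
    (integrable_of_continuous μ (π.continuous_op.comp continuous_inv)) v

theorem map_fourier_apply (μ : Measure G) [IsFiniteMeasure μ] {π σ : UnitaryIrrep G}
    (T : π.V ≃ₗᵢ[ℂ] σ.V) (hT : ∀ (g : G) (v : π.V), T (π.ρ g v) = σ.ρ g (T v)) (v : π.V) :
    T (fourier μ π v) = fourier μ σ (T v) := by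
  rw [fourier_apply, fourier_apply]
  simp_rw [← hT]
  exact (T.toContinuousLinearEquiv.integral_comp_comm _).symm

theorem fourier_eq_of_equivalent {μ ν : Measure G} [IsFiniteMeasure μ] [IsFiniteMeasure ν]
    {π σ : UnitaryIrrep G} (h : π.UnitarilyEquivalent σ) (hσ : fourier μ σ = fourier ν σ) :
    fourier μ π = fourier ν π := by
  obtain ⟨T, hT⟩ := h
  ext v
  apply T.injective
  rw [map_fourier_apply μ T hT, map_fourier_apply ν T hT, hσ]

/-- If the Fourier transforms of two measures agree at all irreducible representations, they agree
at all finite-dimensional unitary representations. -/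
theorem integral_unitary_eq {μ ν : Measure G} [IsFiniteMeasure μ] [IsFiniteMeasure ν]
    (h : ∀ π : UnitaryIrrep G, fourier μ π = fourier ν π) (n : ℕ) :
    ∀ (V : Type) [NormedAddCommGroup V] [InnerProductSpace ℂ V] [FiniteDimensional ℂ V]
      (ρ : Representation ℂ G V), (∀ (g : G) (v w : V), ⟪ρ g v, ρ g w⟫_ℂ = ⟪v, w⟫_ℂ) →
      (∀ v : V, Continuous fun g : G => ρ g v) → Module.finrank ℂ V = n →
      ∀ v : V, ∫ g, ρ g⁻¹ v ∂μ = ∫ g, ρ g⁻¹ v ∂ν := by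
  induction n using Nat.strong_induction_on with
  | _ n ih =>
  intro V _ _ _ ρ hin hcont hn v
  have hsub : ∀ U : Subrepresentation ρ, U.toSubmodule ≠ ⊤ → ∀ u ∈ U.toSubmodule,
      ∫ g, ρ g⁻¹ u ∂μ = ∫ g, ρ g⁻¹ u ∂ν := by
    intro U hU u hu
    have hlt : Module.finrank ℂ U.toSubmodule < n := hn ▸ Submodule.finrank_lt hU
    have key := ih _ hlt U.toSubmodule U.toRepresentation (fun g v w => hin g v w)
      (fun v => (hcont v).subtype_mk _) rfl ⟨u, hu⟩
    have hval (μ : Measure G) [IsFiniteMeasure μ] :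
        ∫ g, ρ g⁻¹ u ∂μ = ((∫ g, U.toRepresentation g⁻¹ ⟨u, hu⟩ ∂μ : U.toSubmodule) : V) := by
      have hint : Integrable (fun g => U.toRepresentation g⁻¹ ⟨u, hu⟩) μ :=
        integrable_of_continuous μ (((hcont u).comp continuous_inv).subtype_mk _)
      exact U.toSubmodule.subtypeL.integral_comp_comm hint
    rw [hval μ, hval ν, key]
  rcases subsingleton_or_nontrivial V with hV | hV
  · exact Subsingleton.elim _ _
  by_cases hirr : ρ.IsIrreducible
  · let π : UnitaryIrrep G := ⟨V, ρ, hin, hcont, hirr⟩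
    have := congrArg (fun A : π.V →L[ℂ] π.V => A v) (h π)
    simpa only [fourier_apply] using this
  · have hbt : (⊥ : Subrepresentation ρ) ≠ ⊤ := by
      intro hbt
      obtain ⟨w, hw⟩ := exists_ne (0 : V)
      have : w ∈ (⊥ : Subrepresentation ρ) := by rw [hbt]; trivial
      exact hw this
    have : ∃ U : Subrepresentation ρ, U ≠ ⊥ ∧ U ≠ ⊤ := by
      by_contra! hU
      exact hirr { exists_pair_ne := ⟨⊥, ⊤, hbt⟩
                   eq_bot_or_eq_top := fun U => or_iff_not_imp_left.2 (hU U) }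
    obtain ⟨U, hU0, hU1⟩ := this
    -- Unitarity makes the orthogonal complement invariant. Both summands are proper, so the
    -- induction on dimension applies to each.
    let U' : Subrepresentation ρ :=
      { toSubmodule := U.toSubmoduleᗮ
        apply_mem_toSubmodule := fun g w hw => by
          rw [Submodule.mem_orthogonal] at hw ⊢
          intro u hu
          have h1 := hw _ (U.apply_mem_toSubmodule g⁻¹ hu)
          rw [← hin g, ← Module.End.mul_apply, ← map_mul] at h1
          simpa using h1 }
    have hUt : U.toSubmodule ≠ ⊤ := fun h => hU1 (Subrepresentation.toSubmodule_injective h)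
    have hUt' : U'.toSubmodule ≠ ⊤ := fun h => hU0 (Subrepresentation.toSubmodule_injective
      ((Submodule.orthogonal_eq_top_iff _).1 h))
    obtain ⟨u, hu, w, hw, rfl⟩ := U.toSubmodule.exists_add_mem_mem_orthogonal v
    have hint (μ : Measure G) [IsFiniteMeasure μ] (v : V) : Integrable (fun g => ρ g⁻¹ v) μ :=
      integrable_of_continuous μ ((hcont v).comp continuous_inv)
    simp only [map_add]
    rw [integral_add (hint μ u) (hint μ w), integral_add (hint ν u) (hint ν w),
      hsub U hUt u hu, hsub U' hUt' w hw]

theorem inner_toLp_leftTranslation (g : G) (f h : C(G, ℂ)) :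
    ⟪ContinuousMap.toLp 2 (haarProb G) ℂ (leftTranslation g f),
      ContinuousMap.toLp 2 (haarProb G) ℂ (leftTranslation g h)⟫_ℂ
    = ⟪ContinuousMap.toLp 2 (haarProb G) ℂ f, ContinuousMap.toLp 2 (haarProb G) ℂ h⟫_ℂ := by
  rw [ContinuousMap.inner_toLp, ContinuousMap.inner_toLp]
  simp only [leftTranslation_apply]
  exact integral_mul_left_eq_self (fun x => h x * (starRingEnd ℂ) (f x)) g⁻¹

/-- Since `f g` is the value at `1` of the translate of `f` by `g⁻¹`, the integral of `f` is a
linear functional of the vector `∫ ρ g⁻¹ f`, which `integral_unitary_eq` controls. -/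
theorem integral_eq_of_mem_invariant {μ ν : Measure G} [IsFiniteMeasure μ] [IsFiniteMeasure ν]
    (h : ∀ π : UnitaryIrrep G, fourier μ π = fourier ν π)
    (W : Subrepresentation (leftTranslation (G := G))) [FiniteDimensional ℂ W.toSubmodule]
    {f : C(G, ℂ)} (hf : f ∈ W) : ∫ g, f g ∂μ = ∫ g, f g ∂ν := by
  set ι := ContinuousMap.toLp (E := ℂ) 2 (haarProb G) ℂ with hι
  have hinj : Function.Injective ι := ContinuousMap.toLp_injective (haarProb G)
  -- The `L²` inner product makes translation unitary on `W`. Euclidean coordinates are needed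
  -- because representation spaces must lie in `Type`, whereas `W` lies in the universe of `G`.
  let W' := W.toSubmodule.map ι.toLinearMap
  let b := (stdOrthonormalBasis ℂ W').repr
  let V := EuclideanSpace ℂ (Fin (Module.finrank ℂ W'))
  let Φ : V ≃ₗ[ℂ] W.toSubmodule :=
    b.symm.toLinearEquiv.trans (Submodule.equivMapOfInjective ι.toLinearMap hinj W.toSubmodule).symm
  have hΦ (v : V) : ι (Φ v) = b.symm v := by
    have := (Submodule.equivMapOfInjective ι.toLinearMap hinj W.toSubmodule).apply_symm_apply
      (b.symm v)
    exact congrArg Subtype.val this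
  have hinner (v w : V) : ⟪v, w⟫_ℂ = ⟪ι (Φ v), ι (Φ w)⟫_ℂ := by
    rw [hΦ, hΦ, ← b.symm.inner_map_map v w]
    rfl
  let ρ : Representation ℂ G V :=
    { toFun := fun g => Φ.symm.toLinearMap ∘ₗ W.toRepresentation g ∘ₗ Φ.toLinearMap
      map_one' := by ext; simp
      map_mul' := fun g h => by ext; simp }
  have hρ (g : G) (v : V) : (Φ (ρ g v) : C(G, ℂ)) = leftTranslation g (Φ v : C(G, ℂ)) := by
    change (Φ (Φ.symm (W.toRepresentation g (Φ v))) : C(G, ℂ)) = _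
    rw [Φ.apply_symm_apply]
    rfl
  have hρin (g : G) (v w : V) : ⟪ρ g v, ρ g w⟫_ℂ = ⟪v, w⟫_ℂ := by
    rw [hinner, hinner, hρ, hρ, inner_toLp_leftTranslation]
  have hρcont (v : V) : Continuous fun g => ρ g v := by
    refine (LinearMap.continuous_of_finiteDimensional Φ.symm.toLinearMap).comp
      ((continuous_leftTranslation (Φ v : C(G, ℂ))).subtype_mk
        fun g => W.apply_mem_toSubmodule g (Φ v).2)
  let v : V := Φ.symm ⟨f, hf⟩
  have key := integral_unitary_eq h _ V ρ hρin hρcont rfl v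
  let ev : V →L[ℂ] ℂ := LinearMap.toContinuousLinearMap
    { toFun := fun v => (Φ v : C(G, ℂ)) 1
      map_add' := fun v w => by simp
      map_smul' := fun c v => by simp }
  have hev (g : G) : f g = ev (ρ g⁻¹ v) := by
    change f g = (Φ (ρ g⁻¹ v) : C(G, ℂ)) 1
    rw [hρ]
    simp [v]
  have hint (μ : Measure G) [IsFiniteMeasure μ] : ∫ g, f g ∂μ = ev (∫ g, ρ g⁻¹ v ∂μ) := by
    simp_rw [hev]
    exact ev.integral_comp_comm (integrable_of_continuous μ ((hρcont v).comp continuous_inv))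
  rw [hint μ, hint ν, key]

/-- Integration of continuous functions against a finite measure. -/
noncomputable def integralFunctional (μ : Measure G) [IsFiniteMeasure μ] : C(G, ℂ) →L[ℂ] ℂ :=
  LinearMap.mkContinuous
    { toFun := fun f => ∫ g, f g ∂μ
      map_add' := fun f h => integral_add (integrable_of_continuous μ f.continuous)
        (integrable_of_continuous μ h.continuous)
      map_smul' := fun c f => integral_const_mul c f } (μ.real Set.univ) fun f => by
    rw [mul_comm]
    exact norm_integral_le_of_norm_le_const (.of_forall f.norm_coe_le_norm)

/-- Uniqueness of the Fourier transform of finite regular measures. -/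
theorem ext_of_fourier_eq [T2Space G] {μ ν : Measure G} [IsFiniteMeasure μ] [IsFiniteMeasure ν]
    [μ.Regular] [ν.Regular] (h : ∀ π : UnitaryIrrep G, fourier μ π = fourier ν π) : μ = ν := by
  have hΛ : integralFunctional μ - integralFunctional ν = 0 :=
    eq_zero_of_forall_invariant _ fun W _ f hf =>
      sub_eq_zero.2 (integral_eq_of_mem_invariant h W hf)
  refine Measure.ext_of_integral_eq_on_compactlySupported fun f => ?_
  let F : C(G, ℂ) := ⟨fun x => (f x : ℂ), by fun_prop⟩
  have hF : ∫ x, (f x : ℂ) ∂μ = ∫ x, (f x : ℂ) ∂ν :=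
    sub_eq_zero.1 (congrArg (fun Λ : C(G, ℂ) →L[ℂ] ℂ => Λ F) hΛ)
  rw [integral_complex_ofReal, integral_complex_ofReal] at hF
  exact_mod_cast hF

end FiniteDimensional

/-! ### Schur's lemma, fixed vectors of a Gelfand pair, and averaging over `K`. -/

section Gelfand

variable {G : Type u} [Group G] [TopologicalSpace G]

namespace UnitaryIrrep

theorem inner_map_left (π : UnitaryIrrep G) (g : G) (v w : π.V) :
    ⟪π.ρ g v, w⟫_ℂ = ⟪v, π.ρ g⁻¹ w⟫_ℂ := by
  rw [← π.inner_map g v, ← Module.End.mul_apply, ← map_mul]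
  simp

theorem mem_fixedSpace {K : ClosedSubgroup G} {π : UnitaryIrrep G} {v : π.V} :
    v ∈ π.fixedSpace K ↔ ∀ k ∈ K, π.ρ k v = v := by
  rw [fixedSpace, Representation.mem_invariants]
  exact Subtype.forall

theorem eq_bot_or_eq_top_of_invariant (π : UnitaryIrrep G) (U : Submodule ℂ π.V)
    (hU : ∀ (g : G), ∀ v ∈ U, π.ρ g v ∈ U) : U = ⊥ ∨ U = ⊤ :=
  (π.irreducible.eq_bot_or_eq_top ⟨U, hU⟩).imp (congrArg Subrepresentation.toSubmodule)
    (congrArg Subrepresentation.toSubmodule)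

/-- Schur's lemma. -/
theorem exists_eq_smul_of_commute (π : UnitaryIrrep G) (T : Module.End ℂ π.V)
    (hT : ∀ (g : G) (v : π.V), T (π.ρ g v) = π.ρ g (T v)) : ∃ c : ℂ, ∀ v, T v = c • v := by
  have := π.nontrivial_space
  obtain ⟨c, hc⟩ := Module.End.exists_eigenvalue T
  refine ⟨c, fun v => ?_⟩
  rcases π.eq_bot_or_eq_top_of_invariant (T.eigenspace c) (fun g v hv => by
    rw [Module.End.mem_eigenspace_iff] at hv ⊢
    rw [hT, hv, map_smul]) with h | h
  · exact absurd h hc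
  · rw [← Module.End.mem_eigenspace_iff, h]
    trivial

end UnitaryIrrep

variable [IsTopologicalGroup G] [CompactSpace G] [MeasurableSpace G] [BorelSpace G]

theorem integrable_inner_smul (π : UnitaryIrrep G) (w v z : π.V) :
    Integrable (fun y => ⟪π.ρ y w, z⟫_ℂ • π.ρ y v) (haarProb G) :=
  integrable_of_continuous _
    (((π.continuous_map w).inner continuous_const).smul (π.continuous_map v))

/-- The integral is linear in `z` and, by unitarity and invariance of Haar measure, commutes with
`π`; Schur's lemma makes it a scalar. -/
theorem exists_integral_inner_smul_eq (π : UnitaryIrrep G) (w v : π.V) :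
    ∃ c : ℂ, ∀ z, ∫ y, ⟪π.ρ y w, z⟫_ℂ • π.ρ y v ∂(haarProb G) = c • z := by
  have hint := integrable_inner_smul π w v
  let T : Module.End ℂ π.V :=
    { toFun := fun z => ∫ y, ⟪π.ρ y w, z⟫_ℂ • π.ρ y v ∂(haarProb G)
      map_add' := fun z z' => by
        simp only [inner_add_right, add_smul]
        exact integral_add (hint z) (hint z')
      map_smul' := fun c z => by
        simp only [inner_smul_right, mul_smul]
        exact integral_smul c _ }
  refine π.exists_eq_smul_of_commute T fun g z => ?_
  change ∫ y, ⟪π.ρ y w, π.ρ g z⟫_ℂ • π.ρ y v ∂(haarProb G) = π.op g (∫ y, _ ∂_)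
  rw [← ContinuousLinearMap.integral_comp_comm _ (hint z), ← integral_mul_left_eq_self _ g]
  simp [π.inner_map]

theorem conv_coefficients (π : UnitaryIrrep G) (u v w z : π.V) (x : G) :
    conv (fun g => ⟪u, π.ρ g v⟫_ℂ) (fun g => ⟪w, π.ρ g z⟫_ℂ) x
      = ⟪u, ∫ y, ⟪π.ρ y w, π.ρ x z⟫_ℂ • π.ρ y v ∂(haarProb G)⟫_ℂ := by
  rw [conv, ← integral_inner (integrable_inner_smul π w v _)]
  refine integral_congr_ae (.of_forall fun y => ?_)
  simp [inner_smul_right, π.inner_map_left y w, mul_comm]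

theorem aeBiInvariant_coefficient {K : ClosedSubgroup G} (π : UnitaryIrrep G) {u v : π.V}
    (hu : u ∈ π.fixedSpace K) (hv : v ∈ π.fixedSpace K) :
    AEBiInvariant K fun g => ⟪u, π.ρ g v⟫_ℂ := by
  rw [UnitaryIrrep.mem_fixedSpace] at hu hv
  intro k hk k' hk'
  refine .of_forall fun g => ?_
  simp only [map_mul, Module.End.mul_apply, hv k' hk']
  rw [← hu k hk, π.inner_map, hu k hk]

/-- For a Gelfand pair the space of fixed vectors is at most one-dimensional. -/
theorem IsGelfandPair.eq_zero_of_inner_eq_zero {K : ClosedSubgroup G} (hGK : IsGelfandPair K)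
    (π : UnitaryIrrep G) {a b : π.V} (ha : a ∈ π.fixedSpace K) (hb : b ∈ π.fixedSpace K)
    (ha0 : a ≠ 0) (hab : ⟪a, b⟫_ℂ = 0) : b = 0 := by
  have hcoef (u v : π.V) : Continuous fun g => ⟪u, π.ρ g v⟫_ℂ :=
    continuous_const.inner (π.continuous_map v)
  obtain ⟨c, hc1⟩ := exists_integral_inner_smul_eq π a a
  obtain ⟨c', hc2⟩ := exists_integral_inner_smul_eq π a b
  have hcomm := hGK (fun g => ⟪a, π.ρ g a⟫_ℂ) (fun g => ⟪a, π.ρ g b⟫_ℂ)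
    (integrable_of_continuous _ (hcoef a a)) (integrable_of_continuous _ (hcoef a b))
    (aeBiInvariant_coefficient π ha ha) (aeBiInvariant_coefficient π ha hb)
  -- Commutativity applied to the coefficients of `(a, a)` and `(a, b)`; continuity upgrades the
  -- almost everywhere equality. At `x = 1` orthogonality then forces `c' = 0`.
  have heq : ∀ x, c * ⟪a, π.ρ x b⟫_ℂ = c' * ⟪a, π.ρ x a⟫_ℂ := by
    have h1 : (fun x => c * ⟪a, π.ρ x b⟫_ℂ) =ᵐ[haarProb G] fun x => c' * ⟪a, π.ρ x a⟫_ℂ := by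
      filter_upwards [hcomm] with x hx
      rwa [conv_coefficients, conv_coefficients, hc1, hc2, inner_smul_right,
        inner_smul_right] at hx
    exact congrFun ((Continuous.ae_eq_iff_eq _ (continuous_const.mul (hcoef a b))
      (continuous_const.mul (hcoef a a))).1 h1)
  have haa : ⟪a, a⟫_ℂ ≠ 0 := inner_self_ne_zero.2 ha0
  have hc'0 : c' = 0 := by
    have := heq 1
    simp only [map_one, Module.End.one_apply, hab, mul_zero] at this
    exact (mul_eq_zero.1 this.symm).resolve_right haa
  -- Pairing the integral at `z = a` with `a` gives `∫ ‖⟪a, π(y)a⟫‖²`, positive since its integrand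
  -- is positive at `1`.
  have hc0 : c ≠ 0 := by
    rintro rfl
    have h1 : ⟪a, ∫ y, ⟪π.ρ y a, a⟫_ℂ • π.ρ y a ∂(haarProb G)⟫_ℂ = 0 := by
      rw [hc1, zero_smul, inner_zero_right]
    rw [← integral_inner (integrable_inner_smul π a a _)] at h1
    have h2 (y : G) : ⟪a, ⟪π.ρ y a, a⟫_ℂ • π.ρ y a⟫_ℂ = ((‖⟪a, π.ρ y a⟫_ℂ‖ ^ 2 : ℝ) : ℂ) := by
      rw [inner_smul_right, ← inner_conj_symm (π.ρ y a) a, Complex.conj_mul']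
      norm_cast
    simp_rw [h2] at h1
    rw [integral_complex_ofReal, Complex.ofReal_eq_zero] at h1
    have hcont : Continuous fun y => ‖⟪a, π.ρ y a⟫_ℂ‖ ^ 2 := (hcoef a a).norm.pow 2
    refine (hcont.integral_pos_of_hasCompactSupport_nonneg_nonzero
      (HasCompactSupport.of_compactSpace _) (fun _ => by positivity) (x := 1) ?_).ne' h1
    simpa using haa
  -- The orthogonal complement of the span of the orbit of `a`: it is invariant and omits `a`, hence
  -- is zero, and `heq` puts `b` in it.
  let U : Submodule ℂ π.V := ⨅ x : G, LinearMap.ker ((innerSL ℂ a).toLinearMap ∘ₗ π.ρ x)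
  have hU (z : π.V) : z ∈ U ↔ ∀ x, ⟪a, π.ρ x z⟫_ℂ = 0 := by simp [U]
  rcases π.eq_bot_or_eq_top_of_invariant U (fun g z hz => by
    rw [hU] at hz ⊢
    intro x
    rw [← Module.End.mul_apply, ← map_mul]
    exact hz _) with h | h
  · rw [← Submodule.mem_bot ℂ, ← h, hU]
    intro x
    have := heq x
    rw [hc'0, zero_mul] at this
    exact (mul_eq_zero.1 this).resolve_left hc0
  · have : a ∈ U := by rw [h]; trivial
    exact absurd (by simpa using (hU a).1 this 1) ha0

instance compactSpace_closedSubgroup (K : ClosedSubgroup G) : CompactSpace K.toSubgroup :=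
  isCompact_iff_compactSpace.mp K.isClosed'.isCompact

theorem avgOp_apply (K : ClosedSubgroup G) (π : UnitaryIrrep G) (v : π.V) :
    avgOp K π v = ∫ k : K.toSubgroup, π.ρ k v ∂(haarProb K.toSubgroup) :=
  ContinuousLinearMap.integral_apply
    (integrable_of_continuous _ (π.continuous_op.comp continuous_subtype_val)) v

theorem map_avgOp_apply {E : Type*} [NormedAddCommGroup E] [NormedSpace ℂ E] [CompleteSpace E]
    (K : ClosedSubgroup G) (π : UnitaryIrrep G) (L : π.V →L[ℂ] E) (v : π.V) :
    L (avgOp K π v) = ∫ k : K.toSubgroup, L (π.ρ k v) ∂(haarProb K.toSubgroup) := by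
  rw [avgOp_apply]
  exact (L.integral_comp_comm (integrable_of_continuous _
    ((π.continuous_map v).comp continuous_subtype_val))).symm

/-- Invariance of Haar measure on `K` makes averages fixed; unitarity gives `⟪u, avgOp K π v⟫ = ⟪u,
v⟫` for fixed `u`, so the error is orthogonal to the fixed space. -/
theorem avgOp_eq_starProjection (K : ClosedSubgroup G) (π : UnitaryIrrep G) :
    avgOp K π = (π.fixedSpace K).starProjection := by
  ext v
  symm
  refine Submodule.eq_starProjection_of_mem_of_inner_eq_zero ?_ ?_
  · rw [UnitaryIrrep.mem_fixedSpace]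
    intro k hk
    change π.op k (avgOp K π v) = _
    rw [map_avgOp_apply, avgOp_apply]
    rw [← integral_mul_left_eq_self (fun k' : K.toSubgroup => π.ρ k' v) ⟨k, hk⟩]
    simp
  · intro u hu
    rw [UnitaryIrrep.mem_fixedSpace] at hu
    have h : ⟪u, avgOp K π v⟫_ℂ = ⟪u, v⟫_ℂ := by
      change innerSL ℂ u (avgOp K π v) = _
      rw [map_avgOp_apply]
      have (k : K.toSubgroup) : innerSL ℂ u (π.ρ k v) = ⟪u, v⟫_ℂ := by
        rw [innerSL_apply_apply]
        nth_rw 1 [← hu k k.2]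
        rw [π.inner_map]
      simp [this]
    rw [← inner_conj_symm, inner_sub_right, h, sub_self, map_zero]

end Gelfand

/-! ### Invariance of measures read off the Fourier transform. -/

section Invariance

variable {G : Type u} [Group G] [TopologicalSpace G] [IsTopologicalGroup G]
  [MeasurableSpace G] [BorelSpace G]

theorem kLeftInvariant_iff_map {K : ClosedSubgroup G} {μ : Measure G} :
    KLeftInvariant K μ ↔ ∀ k ∈ K, μ.map (fun g => k * g) = μ := by
  have himg (k : G) {A : Set G} (hA : MeasurableSet A) :
      μ ((fun g => k⁻¹ * g) '' A) = μ.map (fun g => k * g) A := by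
    rw [Measure.map_apply (by fun_prop) hA, Set.image_mul_left, inv_inv]
  constructor
  · intro h k hk
    ext A hA
    rw [← himg k hA, h _ (inv_mem hk) A hA]
  · intro h k hk A hA
    rw [← inv_inv k, himg _ hA, h _ (inv_mem hk)]

theorem kRightInvariant_iff_map {K : ClosedSubgroup G} {μ : Measure G} :
    KRightInvariant K μ ↔ ∀ k ∈ K, μ.map (fun g => g * k) = μ := by
  have himg (k : G) {A : Set G} (hA : MeasurableSet A) :
      μ ((fun g => g * k⁻¹) '' A) = μ.map (fun g => g * k) A := by
    rw [Measure.map_apply (by fun_prop) hA, Set.image_mul_right, inv_inv]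
  constructor
  · intro h k hk
    ext A hA
    rw [← himg k hA, h _ (inv_mem hk) A hA]
  · intro h k hk A hA
    rw [← inv_inv k, himg _ hA, h _ (inv_mem hk)]

variable [CompactSpace G]

theorem fourier_map_mul_left (μ : Measure G) [IsFiniteMeasure μ] (π : UnitaryIrrep G) (k : G)
    (v : π.V) : fourier (μ.map fun g => k * g) π v = fourier μ π (π.ρ k⁻¹ v) := by
  rw [fourier_apply, fourier_apply, integral_map (by fun_prop)
    (π.continuous_map_inv v).aestronglyMeasurable]
  simp

theorem fourier_map_mul_right (μ : Measure G) [IsFiniteMeasure μ] (π : UnitaryIrrep G) (k : G)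
    (v : π.V) : fourier (μ.map fun g => g * k) π v = π.ρ k⁻¹ (fourier μ π v) := by
  change _ = π.op k⁻¹ (fourier μ π v)
  rw [fourier_apply, fourier_apply, integral_map (by fun_prop)
    (π.continuous_map_inv v).aestronglyMeasurable,
    ← ContinuousLinearMap.integral_comp_comm _
      (integrable_of_continuous μ (π.continuous_map_inv v))]
  simp

theorem avgOp_map_apply {K : ClosedSubgroup G} (π : UnitaryIrrep G) {k : G} (hk : k ∈ K)
    (v : π.V) : avgOp K π (π.ρ k v) = avgOp K π v := by
  rw [← sub_eq_zero, ← map_sub, avgOp_eq_starProjection,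
    Submodule.starProjection_apply_eq_zero_iff, Submodule.mem_orthogonal]
  intro u hu
  rw [UnitaryIrrep.mem_fixedSpace] at hu
  have := π.inner_map k u v
  rw [hu k hk] at this
  rw [inner_sub_right, this, sub_self]

theorem avgOp_apply_eq_self_iff {K : ClosedSubgroup G} {π : UnitaryIrrep G} {v : π.V} :
    avgOp K π v = v ↔ ∀ k ∈ K, π.ρ k v = v := by
  rw [avgOp_eq_starProjection, Submodule.starProjection_eq_self_iff, UnitaryIrrep.mem_fixedSpace]

variable [T2Space G]

theorem ext_of_fourier_rep_eq {rep : UnitaryDual G → UnitaryIrrep G}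
    (hrep : ∀ γ, (Quotient.mk _ (rep γ) : UnitaryDual G) = γ) {μ ν : Measure G}
    [IsFiniteMeasure μ] [IsFiniteMeasure ν] [μ.Regular] [ν.Regular]
    (h : ∀ γ, fourier μ (rep γ) = fourier ν (rep γ)) : μ = ν := by
  refine ext_of_fourier_eq fun π => ?_
  have hπ : UnitaryIrrep.UnitarilyEquivalent (rep (Quotient.mk _ π)) π := Quotient.exact (hrep _)
  exact fourier_eq_of_equivalent (UnitaryIrrep.unitarilyEquivalent_equivalence.symm hπ) (h _)

theorem kLeftInvariant_iff_fourier {rep : UnitaryDual G → UnitaryIrrep G}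
    (hrep : ∀ γ, (Quotient.mk _ (rep γ) : UnitaryDual G) = γ) (K : ClosedSubgroup G)
    (μ : Measure G) [IsFiniteMeasure μ] [μ.Regular] :
    KLeftInvariant K μ ↔
      ∀ γ, fourier μ (rep γ) ∘L avgOp K (rep γ) = fourier μ (rep γ) := by
  rw [kLeftInvariant_iff_map]
  constructor
  · intro h γ
    ext v
    have hk (k : K.toSubgroup) : fourier μ (rep γ) ((rep γ).ρ k v) = fourier μ (rep γ) v := by
      have := fourier_map_mul_left μ (rep γ) (k : G)⁻¹ v
      rwa [h _ (inv_mem k.2), inv_inv, eq_comm] at this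
    rw [ContinuousLinearMap.comp_apply, map_avgOp_apply]
    simp [hk]
  · intro h k hk
    -- Uniqueness is available for regular measures only; homeomorphisms preserve regularity.
    have : (μ.map fun g => k * g).Regular := Measure.Regular.map (Homeomorph.mulLeft k)
    refine ext_of_fourier_rep_eq hrep fun γ => ?_
    ext v
    rw [fourier_map_mul_left, ← h γ, ContinuousLinearMap.comp_apply, ContinuousLinearMap.comp_apply,
      avgOp_map_apply _ (inv_mem hk)]

theorem kRightInvariant_iff_fourier {rep : UnitaryDual G → UnitaryIrrep G}
    (hrep : ∀ γ, (Quotient.mk _ (rep γ) : UnitaryDual G) = γ) (K : ClosedSubgroup G)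
    (μ : Measure G) [IsFiniteMeasure μ] [μ.Regular] :
    KRightInvariant K μ ↔
      ∀ γ, avgOp K (rep γ) ∘L fourier μ (rep γ) = fourier μ (rep γ) := by
  rw [kRightInvariant_iff_map]
  constructor
  · intro h γ
    ext v
    rw [ContinuousLinearMap.comp_apply, avgOp_apply_eq_self_iff]
    intro k hk
    have := fourier_map_mul_right μ (rep γ) k⁻¹ v
    rwa [h _ (inv_mem hk), inv_inv, eq_comm] at this
  · intro h k hk
    have : (μ.map fun g => g * k).Regular := Measure.Regular.map (Homeomorph.mulRight k)
    refine ext_of_fourier_rep_eq hrep fun γ => ?_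
    ext v
    have hv : avgOp K (rep γ) (fourier μ (rep γ) v) = fourier μ (rep γ) v :=
      congrArg (fun A : (rep γ).V →L[ℂ] (rep γ).V => A v) (h γ)
    rw [fourier_map_mul_right]
    exact avgOp_apply_eq_self_iff.1 hv _ (inv_mem hk)

end Invariance

/-! ### Absorption of the projection in terms of matrix entries. -/

section Entries

variable {G : Type u} [Group G] [TopologicalSpace G] {K : ClosedSubgroup G} {π : UnitaryIrrep G}

/-- Used with `X` the transform and `Y` its composite with `avgOp`: off the spherical classes `Y =
X` already says `X = 0`, so (b) is one equation for all classes. -/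
theorem spherical_split_iff {X Y : π.V →L[ℂ] π.V} (hY : ¬ π.IsSpherical K → Y = 0) :
    ((π.IsSpherical K → Y = X) ∧ (¬ π.IsSpherical K → X = 0)) ↔ Y = X := by
  by_cases h : π.IsSpherical K
  · simp [h]
  · simp [h, hY h, eq_comm]

variable [IsTopologicalGroup G] [CompactSpace G] [MeasurableSpace G] [BorelSpace G]

theorem avgOp_comp_avgOp : avgOp K π ∘L avgOp K π = avgOp K π := by
  ext v
  rw [avgOp_eq_starProjection, ContinuousLinearMap.comp_apply,
    Submodule.starProjection_eq_self_iff]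
  exact Submodule.starProjection_apply_mem _ _

theorem avgOp_eq_zero (h : ¬ π.IsSpherical K) : avgOp K π = 0 := by
  have : π.fixedSpace K = ⊥ := by
    rw [Submodule.eq_bot_iff]
    intro v hv
    by_contra hv0
    exact h ⟨v, hv0, UnitaryIrrep.mem_fixedSpace.1 hv⟩
  rw [avgOp_eq_starProjection, this, Submodule.starProjection_bot]

theorem avgOp_sandwich_iff (X : π.V →L[ℂ] π.V) :
    avgOp K π ∘L X ∘L avgOp K π = X ↔ X ∘L avgOp K π = X ∧ avgOp K π ∘L X = X := by
  constructor
  · intro h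
    constructor
    · rw [← h, ContinuousLinearMap.comp_assoc, ContinuousLinearMap.comp_assoc, avgOp_comp_avgOp]
    · nth_rw 1 [← h]
      rw [← ContinuousLinearMap.comp_assoc, avgOp_comp_avgOp, h]
  · rintro ⟨h1, h2⟩
    rw [h1, h2]

/-- The Gelfand property enters here: a fixed vector minus its component along the first basis
vector is fixed and orthogonal to that vector, hence zero, so the other basis vectors are orthogonal
to the fixed space. -/
theorem avgOp_basis (hGK : IsGelfandPair K) (e : OrthonormalBasis (Fin π.dim) ℂ π.V)
    (he : π.IsSpherical K → e π.first ∈ π.fixedSpace K) :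
    (∀ i, π.IsSpherical K ∧ i = π.first → avgOp K π (e i) = e i) ∧
      ∀ i, ¬ (π.IsSpherical K ∧ i = π.first) → avgOp K π (e i) = 0 := by
  constructor
  · rintro _ ⟨h, rfl⟩
    rw [avgOp_eq_starProjection, Submodule.starProjection_eq_self_iff]
    exact he h
  · intro i hi
    by_cases h : π.IsSpherical K
    · have hi' : π.first ≠ i := fun h' => hi ⟨h, h'.symm⟩
      rw [avgOp_eq_starProjection, Submodule.starProjection_apply_eq_zero_iff,
        Submodule.mem_orthogonal']
      intro u hu
      have horth : ⟪e i, e π.first⟫_ℂ = 0 := e.orthonormal.2 hi'.symm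
      have hnorm : ⟪e π.first, e π.first⟫_ℂ = 1 := by
        rw [inner_self_eq_norm_sq_to_K, e.orthonormal.1]; simp
      have hu0 : u - ⟪e π.first, u⟫_ℂ • e π.first = 0 :=
        hGK.eq_zero_of_inner_eq_zero π (he h) (sub_mem hu (Submodule.smul_mem _ _ (he h)))
          (e.orthonormal.ne_zero _) (by rw [inner_sub_right, inner_smul_right, hnorm]; simp)
      rw [sub_eq_zero.1 hu0, inner_smul_right, horth, mul_zero]
    · rw [avgOp_eq_zero h, zero_apply]

theorem comp_avgOp_eq_self_iff (hGK : IsGelfandPair K) (e : OrthonormalBasis (Fin π.dim) ℂ π.V)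
    (he : π.IsSpherical K → e π.first ∈ π.fixedSpace K) (X : π.V →L[ℂ] π.V) :
    X ∘L avgOp K π = X ↔
      ∀ i j, ¬ (π.IsSpherical K ∧ i = π.first) → π.entry e X i j = 0 := by
  obtain ⟨h1, h0⟩ := avgOp_basis hGK e he
  constructor
  · intro h i j hi
    rw [UnitaryIrrep.entry, ← h, ContinuousLinearMap.comp_apply, h0 i hi, map_zero,
      inner_zero_right]
  · intro h
    refine ContinuousLinearMap.coe_injective (e.toBasis.ext fun i => ?_)
    simp only [OrthonormalBasis.coe_toBasis, ContinuousLinearMap.coe_coe,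
      ContinuousLinearMap.comp_apply]
    by_cases hi : π.IsSpherical K ∧ i = π.first
    · rw [h1 i hi]
    · rw [h0 i hi, map_zero]
      refine e.repr.injective (PiLp.ext fun j => ?_)
      rw [e.repr_apply_apply, e.repr_apply_apply, inner_zero_right]
      exact (h i j hi).symm

theorem avgOp_comp_eq_self_iff (hGK : IsGelfandPair K) (e : OrthonormalBasis (Fin π.dim) ℂ π.V)
    (he : π.IsSpherical K → e π.first ∈ π.fixedSpace K) (X : π.V →L[ℂ] π.V) :
    avgOp K π ∘L X = X ↔
      ∀ i j, ¬ (π.IsSpherical K ∧ j = π.first) → π.entry e X i j = 0 := by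
  obtain ⟨h1, h0⟩ := avgOp_basis hGK e he
  have hsymm (v w : π.V) : ⟪v, avgOp K π w⟫_ℂ = ⟪avgOp K π v, w⟫_ℂ := by
    rw [avgOp_eq_starProjection, Submodule.inner_starProjection_left_eq_right]
  constructor
  · intro h i j hj
    rw [UnitaryIrrep.entry, ← h, ContinuousLinearMap.comp_apply, hsymm, h0 j hj,
      inner_zero_left]
  · intro h
    refine ContinuousLinearMap.coe_injective (e.toBasis.ext fun i =>
      e.repr.injective (PiLp.ext fun j => ?_))
    simp only [OrthonormalBasis.coe_toBasis, ContinuousLinearMap.coe_coe,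
      ContinuousLinearMap.comp_apply]
    rw [e.repr_apply_apply, e.repr_apply_apply, hsymm]
    by_cases hj : π.IsSpherical K ∧ j = π.first
    · rw [h1 j hj]
    · rw [h0 j hj, inner_zero_left]
      exact (h i j hj).symm

end Entries

end CompactPair

/-! ### Assembly of the three equivalences. -/

theorem proposition3p2 {G : Type*} [Group G] [TopologicalSpace G] [IsTopologicalGroup G]
    [CompactSpace G] [T2Space G] [MeasurableSpace G] [BorelSpace G]
    (K : ClosedSubgroup G) (hGK : CompactPair.IsGelfandPair K)
    -- a choice of a representative of every class in the unitary dual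
    (rep : CompactPair.UnitaryDual G → CompactPair.UnitaryIrrep G)
    (hrep : ∀ γ, (Quotient.mk _ (rep γ) : CompactPair.UnitaryDual G) = γ)
    -- a choice of orthonormal bases whose first vector is `K`-fixed in the spherical case
    (e : ∀ γ, OrthonormalBasis (Fin (rep γ).dim) ℂ (rep γ).V)
    (he : ∀ γ, (rep γ).IsSpherical K → e γ (rep γ).first ∈ (rep γ).fixedSpace K)
    (μ : MeasureTheory.Measure G) [MeasureTheory.IsFiniteMeasure μ] [μ.Regular] :
    List.TFAE
      [CompactPair.KLeftInvariant K μ,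
        ∀ γ, ((rep γ).IsSpherical K →
            CompactPair.fourier μ (rep γ) ∘L CompactPair.avgOp K (rep γ)
              = CompactPair.fourier μ (rep γ)) ∧
          (¬ (rep γ).IsSpherical K → CompactPair.fourier μ (rep γ) = 0),
        ∀ γ, ∀ i j : Fin (rep γ).dim,
          (¬ (rep γ).IsSpherical K ∨ (rep γ).IsSpherical K ∧ i ≠ (rep γ).first) →
            (rep γ).entry (e γ) (CompactPair.fourier μ (rep γ)) i j = 0] ∧
    List.TFAE
      [CompactPair.KRightInvariant K μ,
        ∀ γ, ((rep γ).IsSpherical K →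
            CompactPair.avgOp K (rep γ) ∘L CompactPair.fourier μ (rep γ)
              = CompactPair.fourier μ (rep γ)) ∧
          (¬ (rep γ).IsSpherical K → CompactPair.fourier μ (rep γ) = 0),
        ∀ γ, ∀ i j : Fin (rep γ).dim,
          (¬ (rep γ).IsSpherical K ∨ (rep γ).IsSpherical K ∧ j ≠ (rep γ).first) →
            (rep γ).entry (e γ) (CompactPair.fourier μ (rep γ)) i j = 0] ∧
    List.TFAE
      [CompactPair.KBiInvariant K μ,
        ∀ γ, ((rep γ).IsSpherical K →
            CompactPair.avgOp K (rep γ) ∘L CompactPair.fourier μ (rep γ) ∘L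
                CompactPair.avgOp K (rep γ)
              = CompactPair.fourier μ (rep γ)) ∧
          (¬ (rep γ).IsSpherical K → CompactPair.fourier μ (rep γ) = 0),
        ∀ γ, ∀ i j : Fin (rep γ).dim,
          (¬ (rep γ).IsSpherical K ∨
              (rep γ).IsSpherical K ∧ ¬ (i = (rep γ).first ∧ j = (rep γ).first)) →
            (rep γ).entry (e γ) (CompactPair.fourier μ (rep γ)) i j = 0] := by

  have hsph (γ) (Z : (rep γ).V →L[ℂ] (rep γ).V) (h : ¬ (rep γ).IsSpherical K) :
      Z ∘L CompactPair.avgOp K (rep γ) = 0 := by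
    rw [CompactPair.avgOp_eq_zero h, ContinuousLinearMap.comp_zero]
  have hsph' (γ) (Z : (rep γ).V →L[ℂ] (rep γ).V) (h : ¬ (rep γ).IsSpherical K) :
      CompactPair.avgOp K (rep γ) ∘L Z = 0 := by
    rw [CompactPair.avgOp_eq_zero h, ContinuousLinearMap.zero_comp]
  have hleft := CompactPair.kLeftInvariant_iff_fourier hrep K μ
  have hright := CompactPair.kRightInvariant_iff_fourier hrep K μ
  have hcol (γ) := CompactPair.comp_avgOp_eq_self_iff hGK (e γ) (he γ)
    (CompactPair.fourier μ (rep γ))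
  have hrow (γ) := CompactPair.avgOp_comp_eq_self_iff hGK (e γ) (he γ)
    (CompactPair.fourier μ (rep γ))
  have hone (γ) (i : Fin (rep γ).dim) :
      (¬ (rep γ).IsSpherical K ∨ (rep γ).IsSpherical K ∧ i ≠ (rep γ).first) ↔
        ¬ ((rep γ).IsSpherical K ∧ i = (rep γ).first) := by tauto
  -- The bi-invariant vanishing pattern is the union of the left and right ones, matching
  -- `avgOp_sandwich_iff`.
  have htwo (γ) (i j : Fin (rep γ).dim) :
      (¬ (rep γ).IsSpherical K ∨
          (rep γ).IsSpherical K ∧ ¬ (i = (rep γ).first ∧ j = (rep γ).first)) ↔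
        ¬ ((rep γ).IsSpherical K ∧ i = (rep γ).first) ∨
          ¬ ((rep γ).IsSpherical K ∧ j = (rep γ).first) := by tauto
  refine ⟨?_, ?_, ?_⟩
  · tfae_have 1 ↔ 2 := by
      rw [hleft]
      exact forall_congr' fun γ => (CompactPair.spherical_split_iff (hsph γ _)).symm
    tfae_have 1 ↔ 3 := by
      rw [hleft]
      exact forall_congr' fun γ => by simp only [hcol, hone]
    tfae_finish
  · tfae_have 1 ↔ 2 := by
      rw [hright]
      exact forall_congr' fun γ => (CompactPair.spherical_split_iff (hsph' γ _)).symm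
    tfae_have 1 ↔ 3 := by
      rw [hright]
      exact forall_congr' fun γ => by simp only [hrow, hone]
    tfae_finish
  · have hbi : CompactPair.KBiInvariant K μ ↔ ∀ γ,
        CompactPair.avgOp K (rep γ) ∘L CompactPair.fourier μ (rep γ) ∘L
          CompactPair.avgOp K (rep γ) = CompactPair.fourier μ (rep γ) := by
      rw [CompactPair.KBiInvariant, hleft, hright, ← forall_and]
      exact forall_congr' fun γ => (CompactPair.avgOp_sandwich_iff _).symm
    tfae_have 1 ↔ 2 := by
      rw [hbi]
      exact forall_congr' fun γ => (CompactPair.spherical_split_iff (hsph' γ _)).symm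
    tfae_have 1 ↔ 3 := by
      rw [hbi]
      refine forall_congr' fun γ => ?_
      simp only [CompactPair.avgOp_sandwich_iff, hcol, hrow, htwo, or_imp, forall_and]
    tfae_finish
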